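/- **Setting.** Let $G$ be a higher-order recursion scheme of order $n\ge 1$ over a ranked alphabet $\Sigma$ ($n$ is the highest order of a non-terminal), with rules $F z_1\cdots z_m\to e_F$ and ground-type start symbol $S$. For each non-terminal $F$, take the tree of the $\eta$-long form of $\lambda z_1\cdots z_m.e_F$. Its levels alternate between lambda nodes $\lambda\overline x$ (dummy, of order $0$, if $\overline x$ is empty; otherwise of order $1+\max_i \mathrm{ord}(x_i)$) and nodes labelled by a variable, by a terminal, or by $@$; an $@$ node stands for the application of a non-terminal to its arguments. The nodes of these finitely many trees form the computation graph of $G$. $E_i(u)$ ($i\ge1$) is the $i$-th child of $u$ in its tree, and $E_0(u)$, for an $@$ node $u$ applying $F$, is the root lambda node of the tree of $F$; the nodes $E_0(u)$ are the *prime* lambda nodes. The span of a variable node is the length of the path from its binder to it. The unfolding of the graph from the root of the tree of $S$ is the computation tree of $G$. $G$ is *incrementally-bound* if every variable node $x$ of the computation tree is bound by the first lambda node, on the path from $x$ to the root, whose order is strictly greater than $\mathrm{ord}(x)$. **$CPDA(G)$** is the order-$n$ tree-generating collapsible pushdown automaton whose stack symbols are the nodes of the computation graph. Each stack symbol carries a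 link $(j,k)$; $push_1^{b,j}$ pushes $b$ with link $(j,1)$; $push_j$ ($2\le j\le n$) duplicates the top $(j-1)$-stack, replacing each link $(j,k)$ in the new copy by $(j,k+1)$; $collapse$ performs $pop_j^k$, where $(j,k)$ is the link of the top symbol. It starts with $push_1^{\lambda}\bot_n$, where $\lambda$ is the root of the tree of $S$. With top symbol $u$ it acts as follows. * (A) If $u$ is an $@$ node: $push_1^{E_0(u),1}$. * (S) If $u$ is labelled by a terminal $f$: output $f$, and in the $i$-th branch ($1\le i\le \mathrm{ar}(f)$) perform $push_1^{E_i(u)}$. * (L) If $u$ is a lambda node: $push_1^{E_1(u)}$. * (V$_1$) If $u$ is a variable of order $l\ge1$ and span $p$, the $i$-th parameter of its binder: $push_{n-l+1};\,pop_1^{p};\,collapse;\,push_1^{E_i(top_1),\,n-l+1}$. * (V$_0$) If $u$ is a variable of order $0$ and span $p$, the $i$-th parameter of its binder: $pop_1^{p};\,collapse;\,push_1^{E_i(top_1)}$. Where no link order is indicated in a $push_1$, it is an arbitrary function, with values in $\{1,\dots,n\}$, of the pushed node. **$PDA(G)$** is the order-$n$ pushdown automaton (without links) obtained from $CPDA(G)$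 by replacing every $collapse$ by $pop_1$ if the top symbol $top_1$ is a prime lambda node, and by $pop_{n-\mathrm{ord}(top_1)+1}$ otherwise. **Theorem (Correctness of the simulation).** If $G$ is incrementally-bound, then $PDA(G)$ and $CPDA(G)$ are equivalent: they generate the same (possibly infinite, possibly partial) $\Sigma$-labelled tree. -/

import Mathlib

/-! # Simple types and recursion schemes -/

/-- Simple types over one atom `o`. -/
inductive Ty where
  | o : Ty
  | arr : Ty → Ty → Ty

namespace Ty

/-- The order of a simple type. -/
def order : Ty → ℕ
  | o => 0
  | arr A B => max (A.order + 1) B.order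

/-- The argument types `A₁, …, Aₘ` of a type `A₁ → ⋯ → Aₘ → o`. -/
def args : Ty → List Ty
  | o => []
  | arr A B => A :: B.args

/-- The type `o → ⋯ → o → o` with `k` arguments. -/
def ofArity : ℕ → Ty
  | 0 => o
  | k + 1 => arr o (ofArity k)

end Ty

/-- Applicative terms generated from the terminals `f : T` (of arity `ar f`), the non-terminals
`F : N` (of type `ty F`) and parameters whose types are listed in `ctx`. -/
inductive ATerm {T : Type*} {N : Type*} (ar : T → ℕ) (ty : N → Ty) (ctx : List Ty) :
    Ty → Type _ where
  | sym (f : T) : ATerm ar ty ctx (Ty.ofArity (ar f))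
  | nt (F : N) : ATerm ar ty ctx (ty F)
  | par (i : Fin ctx.length) : ATerm ar ty ctx (ctx.get i)
  | app {A B : Ty} (s : ATerm ar ty ctx (Ty.arr A B)) (t : ATerm ar ty ctx A) : ATerm ar ty ctx B

/-- Higher-order recursion schemes over the ranked alphabet `T` with arities `ar`. The rule of the
non-terminal `F : A₁ → ⋯ → Aₘ → o` is `F z₁ ⋯ zₘ → rule F`, where `zᵢ : Aᵢ`. -/
structure HORS (T : Type*) (ar : T → ℕ) where
  N : Type*
  [fintypeN : Fintype N]
  ty : N → Ty
  start : N
  ty_start : ty start = Ty.o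
  rule : ∀ F : N, ATerm ar ty (ty F).args Ty.o

attribute [instance] HORS.fintypeN

/-! # Computation trees and the computation graph -/

/-- Finite ordered labelled trees. -/
inductive LTree (L : Type*) where
  | node (label : L) (children : List (LTree L))

namespace LTree

variable {L : Type*}

def label : LTree L → L
  | node l _ => l

def children : LTree L → List (LTree L)
  | node _ ts => ts

/-- The subtree at a position, a position being a list of (0-based) directions from the root. -/
def sub : LTree L → List ℕ → Option (LTree L)
  | t, [] => some t
  | t, i :: w => (t.children[i]?).bind fun t' => t'.sub w

theorem finite_positions : ∀ t : LTree L, {w : List ℕ | (t.sub w).isSome}.Finite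
  | node l ts => by
    have hfin : (⋃ i : Fin ts.length,
        (fun w => (i : ℕ) :: w) '' {w : List ℕ | ((ts.get i).sub w).isSome}).Finite :=
      Set.finite_iUnion fun i => (finite_positions (ts.get i)).image _
    refine (hfin.insert []).subset ?_
    rintro (_ | ⟨i, w⟩) hw
    · exact Set.mem_insert _ _
    · refine Set.mem_insert_of_mem _ ?_
      by_cases hi : i < ts.length
      · refine Set.mem_iUnion.2 ⟨⟨i, hi⟩, w, ?_, rfl⟩
        simpa [sub, children, hi] using hw
      · simp [sub, children, List.getElem?_eq_none (not_lt.1 hi)] at hw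
  termination_by t => sizeOf t
  decreasing_by
    have := List.sizeOf_lt_of_mem (List.get_mem ts i)
    simp
    simp at this
    omega

end LTree

/-- Labels of the nodes of a computation tree: `lam Bs` is a lambda node `λ x₁ ⋯ xₘ` with
`xⱼ : Bⱼ` (dummy if `m = 0`); `var b i A` is a variable of type `A`, namely the one bound at
(0-based) index `i` by the lambda node at depth `b` on the way from the root of the tree to the
variable node; `sym f` is a terminal; `app F` is an application node `@` whose operator is the
non-terminal `F`. -/
inductive Lab (T : Type*) (N : Type*) where
  | lam (Bs : List Ty)
  | var (b : ℕ) (i : ℕ) (A : Ty)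
  | sym (f : T)
  | app (F : N)

namespace Lab

variable {T : Type*} {N : Type*}

/-- The order of a variable node is the order of its type; the order of a lambda node
`λ x₁ ⋯ xₘ` is `1 + maxᵢ ord xᵢ`, and `0` if it is dummy. (Other nodes are of ground type.) -/
def order : Lab T N → ℕ
  | lam Bs => (Bs.map fun B => B.order + 1).foldr max 0
  | var _ _ A => A.order
  | sym _ => 0
  | app _ => 0

def isLam : Lab T N → Bool
  | lam _ => true
  | _ => false

end Lab

/-- For `A = A₁ → ⋯ → Aₘ → o`, the eta-long forms of the variables with indices
`j, …, j + m - 1` and types `A₁, …, Aₘ` bound by a lambda node at depth `k`, each of them placed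
at depth `k + 2`. -/
def etaVars {T : Type*} {N : Type*} : Ty → ℕ → ℕ → List (LTree (Lab T N))
  | Ty.o, _, _ => []
  | Ty.arr A B, k, j =>
    .node (.lam A.args) [.node (.var k j A) (etaVars A (k + 2) 0)] :: etaVars B k (j + 1)

/-- `spine e k ts` is the tree whose root, placed at depth `k`, is the head symbol of `e`, and whose
children are the eta-long forms of the arguments of that head in `e`, followed by the trees `ts`.
An argument `t : A` with `A = A₁ → ⋯ → Aₘ → o` becomes `λ y₁ ⋯ yₘ. t y₁ ⋯ yₘ`, recursively. The
parameters of the rule are bound at the root, at depth `0`. -/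
def ATerm.spine {T : Type*} {N : Type*} {ar : T → ℕ} {ty : N → Ty} {ctx : List Ty} :
    {A : Ty} → ATerm ar ty ctx A → ℕ → List (LTree (Lab T N)) → LTree (Lab T N)
  | _, .sym f, _, ts => .node (.sym f) ts
  | _, .nt F, _, ts => .node (.app F) ts
  | _, .par i, _, ts => .node (.var 0 i (ctx.get i)) ts
  | _, .app (A := A) s t, k, ts =>
    s.spine k (.node (.lam A.args) [t.spine (k + 2) (etaVars A (k + 1) 0)] :: ts)

namespace HORS

variable {T : Type*} {ar : T → ℕ}

/-- The order of a recursion scheme: the highest order of a non-terminal. -/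
def order (G : HORS T ar) : ℕ :=
  Finset.univ.sup fun F => (G.ty F).order

/-- The computation tree of the eta-long form of the term `λ z₁ ⋯ zₘ. e` of a rule
`F z₁ ⋯ zₘ → e`. Non-terminals are not unfolded. -/
def ctree (G : HORS T ar) (F : G.N) : LTree (Lab T G.N) :=
  .node (.lam (G.ty F).args) [(G.rule F).spine 1 []]

/-- The nodes of the computation graph of `G`: the nodes of the finitely many trees `ctree F`. -/
structure Node (G : HORS T ar) where
  nt : G.N
  pos : List ℕ
  valid : ((G.ctree nt).sub pos).isSome

/-- The root lambda node of the tree of `F`. -/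
def root (G : HORS T ar) (F : G.N) : G.Node := ⟨F, [], rfl⟩

instance (G : HORS T ar) : Finite G.Node := by
  have : ∀ F : G.N, Finite {w : List ℕ // ((G.ctree F).sub w).isSome} := fun F =>
    (LTree.finite_positions (G.ctree F)).to_subtype
  refine Finite.of_injective
    (β := Σ F : G.N, {w : List ℕ // ((G.ctree F).sub w).isSome})
    (fun u => ⟨u.nt, u.pos, u.valid⟩) ?_
  rintro ⟨F, w, h⟩ ⟨F', w', h'⟩ e
  obtain ⟨rfl, e⟩ := Sigma.mk.inj e
  obtain rfl := Subtype.mk.inj (eq_of_heq e)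
  rfl

namespace Node

variable {G : HORS T ar}

def label (u : G.Node) : Lab T G.N :=
  (((G.ctree u.nt).sub u.pos).get u.valid).label

def order (u : G.Node) : ℕ := u.label.order

def isLam (u : G.Node) : Bool := u.label.isLam

/-- `u.E i` is the `i`-th child of `u` in the computation graph. The `0`-th child exists only for
an application node, and is the root lambda node of the non-terminal that is applied; the other
children are the children in the tree, numbered from `1`. -/
def E (u : G.Node) : ℕ → Option G.Node
  | 0 =>
    match u.label with
    | .app F => some (G.root F)
    | _ => none
  | i + 1 =>
    if h : ((G.ctree u.nt).sub (u.pos ++ [i])).isSome then some ⟨u.nt, u.pos ++ [i], h⟩ else none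

/-- Prime lambda nodes: those that are the first child of an application node. -/
def IsPrime (u : G.Node) : Prop := ∃ v : G.Node, v.E 0 = some u

/-- The span of a variable node: the length of the path from its binder to it. -/
def span (u : G.Node) : ℕ :=
  match u.label with
  | .var b _ _ => u.pos.length - b
  | _ => 0

/-- The arity of the terminal that labels `u` (and `0` if `u` is not labelled by a terminal). -/
def rank (u : G.Node) : ℕ :=
  match u.label with
  | .sym f => ar f
  | _ => 0

end Node

/-- The nodes of the (in general infinite) computation tree of `G`, the unfolding of the
computation graph from the root of the tree of the start symbol. A node of the unfolding is given
by the path that leads to it, listed from that node up to the root. -/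
inductive IsPath (G : HORS T ar) : List G.Node → Prop
  | root : IsPath G [G.root G.start]
  | child {u v : G.Node} {p : List G.Node} {i : ℕ} :
      IsPath G (u :: p) → u.E i = some v → IsPath G (v :: u :: p)

/-- `G` is incrementally-bound: each variable node `x` of the computation tree of `G` is bound by
the first lambda node on the path from `x` to the root that has order strictly greater than `x`.
(The binder is the node `x.span` steps above `x`.) -/
def IncrementallyBound (G : HORS T ar) : Prop :=
  ∀ (x : G.Node) (p : List G.Node) (b i : ℕ) (A : Ty),
    G.IsPath (x :: p) → x.label = .var b i A →
      p.findIdx (fun u => u.isLam && decide (x.order < u.order)) + 1 = x.span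

end HORS

/-! # Higher-order stacks -/

/-- Order-`n` stacks over `E`. An order-`(n+1)` stack is a sequence of order-`n` stacks; its top is
the head of the list. -/
def Stk (E : Type*) : ℕ → Type _
  | 0 => E
  | n + 1 => List (Stk E n)

namespace Stk

variable {E : Type*}

/-- The stack `push₁ a ⊥ₙ`, for `n ≥ 1`. -/
def single (a : E) : (n : ℕ) → Stk E n
  | 0 => a
  | n + 1 => [single a n]

def top1 : {n : ℕ} → Stk E n → Option E
  | 0, a => some a
  | _ + 1, [] => none
  | _ + 1, t :: _ => top1 t

def push1 (a : E) : {n : ℕ} → Stk E n → Option (Stk E n)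
  | 0, _ => none
  | 1, s => some (a :: s)
  | _ + 2, [] => none
  | _ + 2, t :: s => (push1 a t).map (· :: s)

/-- The operation `pop_j`, defined if `1 ≤ j ≤ n` and the top order-`j` stack is not empty. -/
def pop (j : ℕ) : {n : ℕ} → Stk E n → Option (Stk E n)
  | 0, _ => none
  | _ + 1, [] => none
  | n + 1, t :: s => if j = n + 1 then some s else (pop j t).map (· :: s)

/-- Apply a function to all the symbols of a stack. -/
def map (g : E → E) : {n : ℕ} → Stk E n → Stk E n
  | 0, a => g a
  | _ + 1, s => List.map (map g) s

/-- Replace the top order-`(j-1)` stack `t` by `t` with `h t` on top of it, if `1 ≤ j ≤ n`. -/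
def dup (h : {m : ℕ} → Stk E m → Stk E m) (j : ℕ) : {n : ℕ} → Stk E n → Option (Stk E n)
  | 0, _ => none
  | _ + 1, [] => none
  | n + 1, t :: s => if j = n + 1 then some (h t :: t :: s) else (dup h j t).map (· :: s)

end Stk

/-- Operations of an order-`n` pushdown automaton: `push₁ᵃ`, `push_j` for `j ≥ 2`, and `pop_j`. -/
inductive PDAOp (Γ : Type*) where
  | push1 (a : Γ)
  | push (j : ℕ)
  | pop (j : ℕ)

/-- The effect of an operation on an order-`n` stack (`none` if it is undefined). -/
def PDAOp.apply {Γ : Type*} {n : ℕ} : PDAOp Γ → Stk Γ n → Option (Stk Γ n)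
  | push1 a, s => s.push1 a
  | push j, s => if 2 ≤ j then s.dup (fun t => t) j else none
  | pop j, s => s.pop j

/-- A stack symbol `a^(j,k)` with a link of order `j` and height `k`. -/
structure LinkSym (Γ : Type*) where
  sym : Γ
  ord : ℕ
  height : ℕ

/-- The operation `(·)^⟨j⟩` on symbols: it increments the height of links of order `j`. -/
def LinkSym.incr {Γ : Type*} (j : ℕ) (a : LinkSym Γ) : LinkSym Γ :=
  if a.ord = j then { a with height := a.height + 1 } else a

/-- Operations of an order-`n` collapsible pushdown automaton: `push₁^(a,i)` for `1 ≤ i ≤ n`,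
`push_j` for `j ≥ 2`, `pop_j`, and `collapse`. -/
inductive CPDAOp (Γ : Type*) where
  | push1 (a : Γ) (i : ℕ)
  | push (j : ℕ)
  | pop (j : ℕ)
  | collapse

/-- The effect of an operation on an order-`n` stack with links (`none` if it is undefined). -/
def CPDAOp.apply {Γ : Type*} {n : ℕ} :
    CPDAOp Γ → Stk (LinkSym Γ) n → Option (Stk (LinkSym Γ) n)
  | push1 a i, s => if 1 ≤ i ∧ i ≤ n then s.push1 ⟨a, i, 1⟩ else none
  | push j, s => if 2 ≤ j then s.dup (fun t => t.map (LinkSym.incr j)) j else none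
  | pop j, s => s.pop j
  | collapse, s => s.top1.bind fun a => (fun r => r.bind (Stk.pop a.ord))^[a.height] (some s)

/-! # Tree-generating automata -/

/-- A transition: perform a stack operation and change the state, or output a terminal `f`
together with one state for each child of the node so produced. -/
inductive Transition {T : Type*} (ar : T → ℕ) (Q : Type*) (Op : Type*) where
  | op (q : Q) (θ : Op)
  | out (f : T) (q : Fin (ar f) → Q)

/-- What a configuration of an automaton does next: move silently to another configuration, or
produce a node labelled `f` and spawn a configuration for each of its children. -/
inductive Move {T : Type*} (ar : T → ℕ) (C : Type*) where
  | silent (c : C)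
  | emit (f : T) (c : Fin (ar f) → C)

namespace Move

variable {T : Type*} {ar : T → ℕ} {C : Type*}

/-- The silent moves of an automaton given by `β` (`none`: the automaton is stuck). -/
def silentStep (β : C → Option (Move ar C)) (c : C) : Option C :=
  match β c with
  | some (silent c') => some c'
  | _ => none

/-- The tree generated from a configuration, as the partial function that maps a position (the list
of 0-based directions from the root) to the label of the tree there. It is undefined outside
the tree, and where the automaton gets stuck or runs forever without any output. -/
noncomputable def tree (β : C → Option (Move ar C)) : C → List ℕ → Part T
  | c, [] => (StateTransition.eval (silentStep β) c).bind fun c' =>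
    match β c' with
    | some (emit f _) => Part.some f
    | _ => Part.none
  | c, i :: w => (StateTransition.eval (silentStep β) c).bind fun c' =>
    match β c' with
    | some (emit f k) => if h : i < ar f then tree β (k ⟨i, h⟩) w else Part.none
    | _ => Part.none

end Move

/-- Tree-generating order-`n` pushdown automata. The initial configuration has state `q0` and stack
`push₁ a ⊥ₙ`, where `a` is `init`. -/
structure PDA {T : Type*} (ar : T → ℕ) (n : ℕ) where
  Q : Type*
  Γ : Type*
  finiteQ : Finite Q
  finiteΓ : Finite Γ
  δ : Q → Γ → Option (Transition ar Q (PDAOp Γ))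
  q0 : Q
  init : Γ

/-- Tree-generating order-`n` collapsible pushdown automata. The initial configuration has state
`q0` and stack `push₁^(a,i) ⊥ₙ`, where `a` is `init` and `i` is `initLink`. -/
structure CPDA {T : Type*} (ar : T → ℕ) (n : ℕ) where
  Q : Type*
  Γ : Type*
  finiteQ : Finite Q
  finiteΓ : Finite Γ
  δ : Q → Γ → Option (Transition ar Q (CPDAOp Γ))
  q0 : Q
  init : Γ
  initLink : ℕ

section Automata

variable {T : Type*} {ar : T → ℕ} {n : ℕ}

/-- The moves of the configurations of a pushdown automaton. -/
def PDA.move (A : PDA ar n) (c : A.Q × Stk A.Γ n) : Option (Move ar (A.Q × Stk A.Γ n)) :=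
  c.2.top1.bind fun a => (A.δ c.1 a).bind fun
    | .op q θ => (θ.apply c.2).map fun s => .silent (q, s)
    | .out f q => some (.emit f fun i => (q i, c.2))

/-- The tree generated by a pushdown automaton. -/
noncomputable def PDA.tree (A : PDA ar n) : List ℕ → Part T :=
  Move.tree A.move (A.q0, Stk.single A.init n)

/-- The moves of the configurations of a collapsible pushdown automaton. -/
def CPDA.move (A : CPDA ar n) (c : A.Q × Stk (LinkSym A.Γ) n) :
    Option (Move ar (A.Q × Stk (LinkSym A.Γ) n)) :=
  c.2.top1.bind fun a => (A.δ c.1 a.sym).bind fun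
    | .op q θ => (θ.apply c.2).map fun s => .silent (q, s)
    | .out f q => some (.emit f fun i => (q i, c.2))

/-- The tree generated by a collapsible pushdown automaton. -/
noncomputable def CPDA.tree (A : CPDA ar n) : List ℕ → Part T :=
  Move.tree A.move (A.q0, Stk.single ⟨A.init, A.initLink, 1⟩ n)

/-- The pushdown automaton obtained from a collapsible one by forgetting links and replacing each
`collapse`, performed when the top symbol is `a`, by `pop_(r a)`. -/
def CPDA.replaceCollapse (A : CPDA ar n) (r : A.Γ → ℕ) : PDA ar n where
  Q := A.Q
  Γ := A.Γ
  finiteQ := A.finiteQ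
  finiteΓ := A.finiteΓ
  q0 := A.q0
  init := A.init
  δ q a := (A.δ q a).map fun
    | .op q' (.push1 b _) => .op q' (.push1 b)
    | .op q' (.push j) => .op q' (.push j)
    | .op q' (.pop j) => .op q' (.pop j)
    | .op q' .collapse => .op q' (.pop (r a))
    | .out f k => .out f k

end Automata

/-! # The automata of a recursion scheme -/

namespace HORS

variable {T : Type*} {ar : T → ℕ}

/-- The states of `CPDA(G)`. `main` is the state between two steps. `branch u i` is entered after the
terminal at `u` was output, in the `i`-th branch. `unwind x r` and `enter x` occur within the step
of the variable node `x`: before the last `r` of its `pop₁` operations (`collapse` comes next if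
`r = 0`), and before its final `push₁`. -/
inductive State (G : HORS T ar) where
  | main
  | branch (u : G.Node) (i : Fin u.rank)
  | unwind (x : G.Node) (r : Fin (x.span + 1))
  | enter (x : G.Node)

instance (G : HORS T ar) : Finite G.State := by
  refine Finite.of_surjective
    (α := Unit ⊕ (Σ u : G.Node, Fin u.rank) ⊕ (Σ x : G.Node, Fin (x.span + 1)) ⊕ G.Node)
    (fun
      | .inl _ => .main
      | .inr (.inl ⟨u, i⟩) => .branch u i
      | .inr (.inr (.inl ⟨x, r⟩)) => .unwind x r
      | .inr (.inr (.inr x)) => .enter x) ?_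
  rintro (_ | ⟨u, i⟩ | ⟨x, r⟩ | x)
  · exact ⟨.inl (), rfl⟩
  · exact ⟨.inr (.inl ⟨u, i⟩), rfl⟩
  · exact ⟨.inr (.inr (.inl ⟨x, r⟩)), rfl⟩
  · exact ⟨.inr (.inr (.inr x)), rfl⟩

/-- The transition function of `CPDA(G)`, with one stack operation per transition, where `n` is the
order of `G`. In state `main` with top symbol `u`:
* `(A)` at an application node, `push₁^(E₀ u, 1)`;
* `(S)` at a terminal `f`, output `f`, and then `push₁^(Eᵢ u)` in the `i`-th branch;
* `(L)` at a lambda node, `push₁^(E₁ u)`;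
* `(V₁)` at a variable of order `l ≥ 1` and span `p` that is the `i`-th parameter of its binder,
  `push_(n-l+1); pop₁^p; collapse; push₁^(Eᵢ top₁, n-l+1)`;
* `(V₀)` at such a variable of order `0`, `pop₁^p; collapse; push₁^(Eᵢ top₁)`.

The order of the link is not determined for the operations `push₁ᵛ` of `(S)`, `(L)` and `(V₀)`;
it is `d v`. -/
def delta (G : HORS T ar) (d : G.Node → ℕ) :
    G.State → G.Node → Option (Transition ar G.State (CPDAOp G.Node))
  | .main, u =>
    match hu : u.label with
    | .app _ => (u.E 0).map fun v => .op .main (.push1 v 1)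
    | .sym f => some (.out f fun i => .branch u (i.cast (by simp [Node.rank, hu])))
    | .lam _ => (u.E 1).map fun v => .op .main (.push1 v (d v))
    | .var _ _ A =>
      if 1 ≤ A.order then
        some (.op (.unwind u (Fin.last _)) (.push (G.order - A.order + 1)))
      else
        some (.op (.unwind u ⟨u.span - 1, by omega⟩) (.pop 1))
  | .branch _ i, u => (u.E (i + 1)).map fun v => .op .main (.push1 v (d v))
  | .unwind x ⟨0, _⟩, _ => some (.op (.enter x) .collapse)
  | .unwind x ⟨r + 1, h⟩, _ => some (.op (.unwind x ⟨r, by omega⟩) (.pop 1))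
  | .enter x, u =>
    match x.label with
    | .var _ i A =>
      (u.E (i + 1)).map fun v =>
        .op .main (.push1 v (if 1 ≤ A.order then G.order - A.order + 1 else d v))
    | _ => none

/-- The collapsible pushdown automaton `CPDA(G)`; its order is the order of `G`. -/
def cpda (G : HORS T ar) (d : G.Node → ℕ) : CPDA ar G.order where
  Q := G.State
  Γ := G.Node
  finiteQ := inferInstance
  finiteΓ := inferInstance
  δ := G.delta d
  q0 := .main
  init := G.root G.start
  initLink := d (G.root G.start)

open Classical in
/-- The pushdown automaton `PDA(G)`: each `collapse` of `CPDA(G)` is replaced by `pop₁` if the top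
symbol is a prime lambda node, and by `pop_(n - ord top₁ + 1)` otherwise. -/
noncomputable def pda (G : HORS T ar) (d : G.Node → ℕ) : PDA ar G.order :=
  (G.cpda d).replaceCollapse fun u : G.Node => if u.IsPrime then 1 else G.order - u.order + 1

end HORS

/-! # Simulations between tree-generating systems -/

namespace Move

variable {T : Type*} {ar : T → ℕ} {C C' : Type*}

/-! Erasing links maps configurations of `CPDA(G)` to configurations of `PDA(G)`. By `Move.tree_map`
it suffices that this map commutes with the moves on a set of configurations closed under them. Only
`collapse` is at issue: it must meet a link of height 1 whose order is the one that `PDA(G)` pops.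
Copying raises heights, so this cannot be asked of every symbol; the invariant, built on
`WellLinked`, asks it only where a collapse may still happen.

The top order-1 stack spells a path of the computation tree. By incremental binding, a variable of
order l unwinds to the first lambda node of order greater than l. So collapses occur only at
records: lambda nodes whose order exceeds those of all lambda nodes above them in the stack.

A record of order l' has link order 1 if it is prime and n - l' + 1 otherwise. The copy made at a
variable of order l ≥ 1 increments only links of order n - l + 1, which is larger than the link
order of every record with l' > l; these stay correct in the copy (`WellLinked.topMap`). Links at
lambda nodes of order at most l may be spoiled, but the step ends by pushing a lambda node of order
l, below which they are no longer records (`WellLinked.push_link`). The link of that new node is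
correct too: every pop since the copy has order below n - l + 1, so popping at order n - l + 1 still
returns to the original stack, with the variable on top (`Copied`). -/

def map (f : C → C') : Move ar C → Move ar C'
  | silent c => silent (f c)
  | emit g k => emit g fun i => f (k i)

theorem silentStep_eq_some {β : C → Option (Move ar C)} {c c' : C} :
    silentStep β c = some c' ↔ β c = some (silent c') := by
  unfold silentStep
  split <;> simp_all

variable {β : C → Option (Move ar C)} {β' : C' → Option (Move ar C')} {f : C → C'}
  {I : C → Prop}

theorem silentStep_map {c : C} (h : β' (f c) = (β c).map (map f)) :
    silentStep β' (f c) = (silentStep β c).map f := by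
  unfold silentStep
  rw [h]
  rcases β c with _ | (_ | _) <;> rfl

theorem reaches_map (h : ∀ c, I c → β' (f c) = (β c).map (map f))
    (hs : ∀ c c', I c → β c = some (silent c') → I c') {c c' : C} (hc : I c)
    (hr : StateTransition.Reaches (silentStep β) c c') :
    I c' ∧ StateTransition.Reaches (silentStep β') (f c) (f c') := by
  induction hr with
  | refl => exact ⟨hc, .refl⟩
  | @tail b e _ hbe ih =>
    refine ⟨hs _ _ ih.1 (silentStep_eq_some.1 hbe), ih.2.tail ?_⟩
    rw [silentStep_map (h _ ih.1), Option.mem_def.1 hbe]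
    rfl

/-- The converse direction: on the image of the invariant the target system has no silent steps of
its own. Hence divergence and deadlock are transferred as well as output. -/
theorem reaches_of_map (h : ∀ c, I c → β' (f c) = (β c).map (map f))
    (hs : ∀ c c', I c → β c = some (silent c') → I c') {c : C} {e : C'} (hc : I c)
    (hr : StateTransition.Reaches (silentStep β') (f c) e) :
    ∃ c', e = f c' ∧ StateTransition.Reaches (silentStep β) c c' := by
  induction hr with
  | refl => exact ⟨c, rfl, .refl⟩
  | tail _ hbe ih =>
    obtain ⟨b, rfl, hb⟩ := ih
    rw [silentStep_map (h _ (reaches_map h hs hc hb).1), Option.mem_def, Option.map_eq_some_iff] at hbe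
    obtain ⟨c', hc', rfl⟩ := hbe
    exact ⟨c', rfl, hb.tail hc'⟩

theorem eval_map (h : ∀ c, I c → β' (f c) = (β c).map (map f))
    (hs : ∀ c c', I c → β c = some (silent c') → I c') {c : C} (hc : I c) :
    StateTransition.eval (silentStep β') (f c) =
      (StateTransition.eval (silentStep β) c).map f := by
  ext e
  simp only [Part.mem_map_iff, StateTransition.mem_eval]
  constructor
  · rintro ⟨hr, he⟩
    obtain ⟨c', rfl, hc'⟩ := reaches_of_map h hs hc hr
    rw [silentStep_map (h _ (reaches_map h hs hc hc').1), Option.map_eq_none_iff] at he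
    exact ⟨c', ⟨hc', he⟩, rfl⟩
  · rintro ⟨c', ⟨hr, he⟩, rfl⟩
    obtain ⟨hi, hr'⟩ := reaches_map h hs hc hr
    exact ⟨hr', by rw [silentStep_map (h _ hi), he]; rfl⟩

/-- Needed because the two continuations agree only at reachable configurations, where the invariant
is known. -/
theorem _root_.Part.bind_congr_of_mem {α γ : Type*} {x : Part α} {g h : α → Part γ}
    (e : ∀ a ∈ x, g a = h a) : x.bind g = x.bind h := by
  ext y
  simp only [Part.mem_bind_iff]
  exact exists_congr fun a => and_congr_right fun ha => by rw [e a ha]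

/-- Systems related by a map that commutes with the moves, on the configurations that satisfy an
invariant, generate the same tree. -/
theorem tree_map (h : ∀ c, I c → β' (f c) = (β c).map (map f))
    (hs : ∀ c c', I c → β c = some (silent c') → I c')
    (he : ∀ c g k, I c → β c = some (emit g k) → ∀ i, I (k i)) (w : List ℕ) (c : C) (hc : I c) :
    tree β' (f c) w = tree β c w := by
  induction w generalizing c with
  | nil =>
    simp only [tree]
    rw [eval_map h hs hc, Part.bind_map]
    refine Part.bind_congr_of_mem fun b hb => ?_
    rw [h b (reaches_map h hs hc (StateTransition.mem_eval.1 hb).1).1]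
    rcases β b with _ | (_ | _) <;> rfl
  | cons i w ih =>
    simp only [tree]
    rw [eval_map h hs hc, Part.bind_map]
    refine Part.bind_congr_of_mem fun b hb => ?_
    have hi := (reaches_map h hs hc (StateTransition.mem_eval.1 hb).1).1
    rw [h b hi]
    rcases hb : β b with _ | (_ | ⟨g, k⟩)
    · rfl
    · rfl
    · simp only [Option.map_some, map]
      split_ifs with hlt
      · exact ih _ (he b g k hi hb _)
      · rfl

end Move

/-! # Stacks -/

namespace Stk

variable {E F : Type*} {n : ℕ}

/-- The empty stack of positive order. -/
def nil : Stk E (n + 1) := List.nil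

/-- A stack with one more stack of the next lower order on top. -/
def cons (t : Stk E n) (s : Stk E (n + 1)) : Stk E (n + 1) := List.cons t s

theorem eq_nil_or_cons (s : Stk E (n + 1)) : s = nil ∨ ∃ t r, s = cons t r := by
  rcases s with _ | ⟨t, r⟩
  · exact .inl rfl
  · exact .inr ⟨t, r, rfl⟩

theorem pop_cons (j : ℕ) (t : Stk E n) (r : Stk E (n + 1)) :
    (cons t r).pop j = if j = n + 1 then some r else (t.pop j).map fun u => cons u r := rfl

theorem push1_cons (a : E) (t : Stk E (n + 1)) (r : Stk E (n + 2)) :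
    (cons t r).push1 a = (t.push1 a).map fun u => cons u r := rfl

theorem map_cons (g : E → E) (t : Stk E n) (r : Stk E (n + 1)) :
    (cons t r).map g = cons (t.map g) (r.map g) := rfl

theorem dup_cons (h : {m : ℕ} → Stk E m → Stk E m) (j : ℕ) (t : Stk E n) (r : Stk E (n + 1)) :
    (cons t r).dup h j =
      if j = n + 1 then some (cons (h t) (cons t r)) else (t.dup h j).map fun u => cons u r := rfl

/-- Apply a function to all symbols of a stack, possibly changing the type of the symbols. -/
def mapTo (g : E → F) : {n : ℕ} → Stk E n → Stk F n
  | 0, a => g a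
  | _ + 1, s => List.map (mapTo g) s

theorem mapTo_cons (g : E → F) (t : Stk E n) (r : Stk E (n + 1)) :
    (cons t r).mapTo g = cons (t.mapTo g) (r.mapTo g) := rfl

theorem mapTo_single (g : E → F) (a : E) (n : ℕ) : mapTo g (single a n) = single (g a) n := by
  induction n with
  | zero => rfl
  | succ n ih =>
    change cons (mapTo g (single a n)) nil = cons (single (g a) n) nil
    rw [ih]

theorem top1_single (a : E) (n : ℕ) : (single a n).top1 = some a := by
  induction n with
  | zero => rfl
  | succ n ih => exact ih

theorem top1_mapTo (g : E → F) (s : Stk E n) : (s.mapTo g).top1 = s.top1.map g := by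
  induction n with
  | zero => rfl
  | succ n ih =>
    obtain rfl | ⟨t, r, rfl⟩ := s.eq_nil_or_cons
    · rfl
    · exact ih t

theorem push1_mapTo (g : E → F) (a : E) (s : Stk E n) :
    (s.mapTo g).push1 (g a) = (s.push1 a).map (mapTo g) := by
  induction n with
  | zero => rfl
  | succ n ih =>
    rcases n with _ | n
    · rfl
    · obtain rfl | ⟨t, r, rfl⟩ := s.eq_nil_or_cons
      · rfl
      · rw [mapTo_cons, push1_cons, push1_cons, ih t, Option.map_map, Option.map_map]
        rfl

theorem pop_mapTo (g : E → F) (j : ℕ) (s : Stk E n) :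
    (s.mapTo g).pop j = (s.pop j).map (mapTo g) := by
  induction n with
  | zero => rfl
  | succ n ih =>
    obtain rfl | ⟨t, r, rfl⟩ := s.eq_nil_or_cons
    · rfl
    · rw [mapTo_cons, pop_cons, pop_cons]
      split_ifs
      · rfl
      · rw [ih t, Option.map_map, Option.map_map]
        rfl

theorem mapTo_map (g : E → F) (h : E → E) (hg : ∀ a, g (h a) = g a) (s : Stk E n) :
    (s.map h).mapTo g = s.mapTo g := by
  induction n with
  | zero => exact hg s
  | succ n ih =>
    simp only [map, mapTo]
    exact (List.map_map ..).trans (List.map_congr_left fun t _ => ih t)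

/-- With `g` erasing links and `h` incrementing their heights, the copy differs from the original
only in what `g` forgets. -/
theorem dup_mapTo (g : E → F) (h : E → E) (hg : ∀ a, g (h a) = g a) (j : ℕ) (s : Stk E n) :
    (s.mapTo g).dup (fun t => t) j = (s.dup (fun t => t.map h) j).map (mapTo g) := by
  induction n with
  | zero => rfl
  | succ n ih =>
    obtain rfl | ⟨t, r, rfl⟩ := s.eq_nil_or_cons
    · rfl
    · rw [mapTo_cons, dup_cons, dup_cons]
      split_ifs
      · rw [Option.map_some, mapTo_cons, mapTo_cons, mapTo_map g h hg]
      · rw [ih t, Option.map_map, Option.map_map]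
        rfl

theorem top1_map (h : E → E) (s : Stk E n) : (s.map h).top1 = s.top1.map h := by
  induction n with
  | zero => rfl
  | succ n ih =>
    obtain rfl | ⟨t, r, rfl⟩ := s.eq_nil_or_cons
    · rfl
    · exact ih t

theorem pop_map (h : E → E) (j : ℕ) (s : Stk E n) :
    (s.map h).pop j = (s.pop j).map (map h) := by
  induction n with
  | zero => rfl
  | succ n ih =>
    obtain rfl | ⟨t, r, rfl⟩ := s.eq_nil_or_cons
    · rfl
    · rw [map_cons, pop_cons, pop_cons]
      split_ifs
      · rfl
      · rw [ih t, Option.map_map, Option.map_map]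
        rfl

/-! ### Interaction of pops, pushes and copies -/

theorem pop_cons_eq_some {j : ℕ} {t : Stk E n} {r s : Stk E (n + 1)}
    (h : (cons t r).pop j = some s) :
    j = n + 1 ∧ s = r ∨ j ≠ n + 1 ∧ ∃ u, t.pop j = some u ∧ s = cons u r := by
  rw [pop_cons] at h
  split_ifs at h with hj
  · exact .inl ⟨hj, (Option.some.inj h).symm⟩
  · obtain ⟨u, hu, rfl⟩ := Option.map_eq_some_iff.1 h
    exact .inr ⟨hj, u, hu, rfl⟩

theorem pop_cons_of_ne {j : ℕ} {t u : Stk E n} {r : Stk E (n + 1)} (hj : j ≠ n + 1)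
    (h : t.pop j = some u) : (cons t r).pop j = some (cons u r) := by
  rw [pop_cons, if_neg hj, h]
  rfl

theorem dup_cons_eq_some {h : {m : ℕ} → Stk E m → Stk E m} {j : ℕ} {t : Stk E n}
    {r s : Stk E (n + 1)} (hs : (cons t r).dup h j = some s) :
    j = n + 1 ∧ s = cons (h t) (cons t r) ∨
      j ≠ n + 1 ∧ ∃ u, t.dup h j = some u ∧ s = cons u r := by
  rw [dup_cons] at hs
  split_ifs at hs with hj
  · exact .inl ⟨hj, (Option.some.inj hs).symm⟩
  · obtain ⟨u, hu, rfl⟩ := Option.map_eq_some_iff.1 hs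
    exact .inr ⟨hj, u, hu, rfl⟩

theorem top1_push1 {a : E} {s s' : Stk E n} (h : s.push1 a = some s') : s'.top1 = some a := by
  induction n with
  | zero => cases h
  | succ n ih =>
    rcases n with _ | n
    · rw [← Option.some.inj h]
      rfl
    · obtain rfl | ⟨t, r, rfl⟩ := s.eq_nil_or_cons
      · cases h
      · obtain ⟨u, hu, rfl⟩ := Option.map_eq_some_iff.1 ((push1_cons ..).symm.trans h)
        exact ih hu

theorem pop_of_lt {j : ℕ} {s : Stk E n} (h : n < j) : s.pop j = none := by
  induction n with
  | zero => rfl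
  | succ n ih =>
    obtain rfl | ⟨t, r, rfl⟩ := s.eq_nil_or_cons
    · rfl
    · rw [pop_cons, if_neg (by omega), ih (by omega)]
      rfl

theorem pop_one_push1 {a : E} {s s' : Stk E n} (h : s.push1 a = some s') :
    s'.pop 1 = some s := by
  induction n with
  | zero => cases h
  | succ n ih =>
    rcases n with _ | n
    · rw [← Option.some.inj h]
      rfl
    · obtain rfl | ⟨t, r, rfl⟩ := s.eq_nil_or_cons
      · cases h
      · obtain ⟨u, hu, rfl⟩ := Option.map_eq_some_iff.1 ((push1_cons ..).symm.trans h)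
        exact pop_cons_of_ne (by omega) (ih hu)

theorem pop_push1 {a : E} {j : ℕ} (hj : 2 ≤ j) {s s' : Stk E n} (h : s.push1 a = some s') :
    s'.pop j = s.pop j := by
  induction n with
  | zero => cases h
  | succ n ih =>
    rcases n with _ | n
    · rw [pop_of_lt (by omega), pop_of_lt (by omega)]
    · obtain rfl | ⟨t, r, rfl⟩ := s.eq_nil_or_cons
      · cases h
      · obtain ⟨u, hu, rfl⟩ := Option.map_eq_some_iff.1 ((push1_cons ..).symm.trans h)
        rw [pop_cons, pop_cons, ih hu]

/-- A pop of order `i < j` changes only the top order-`(j-1)` stack, which `pop_j` discards. This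
keeps the target of a future link fixed during unwinding. -/
theorem pop_pop_of_lt {i j : ℕ} (hij : i < j) {s s' s₀ : Stk E n} (h₀ : s.pop j = some s₀)
    (hs : s.pop i = some s') : s'.pop j = some s₀ := by
  induction n with
  | zero => cases hs
  | succ n ih =>
    obtain rfl | ⟨t, r, rfl⟩ := s.eq_nil_or_cons
    · cases hs
    · obtain ⟨hj, rfl⟩ | ⟨hj, u, hu, rfl⟩ := pop_cons_eq_some h₀
      · obtain ⟨hi, -⟩ | ⟨hi, v, hv, rfl⟩ := pop_cons_eq_some hs
        · omega
        · rw [pop_cons, if_pos hj]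
      · obtain ⟨hi, -⟩ | ⟨hi, v, hv, rfl⟩ := pop_cons_eq_some hs
        · rw [pop_of_lt (by omega)] at hu
          cases hu
        · exact pop_cons_of_ne hj (ih hu hv)

theorem pop_dup {h : {m : ℕ} → Stk E m → Stk E m} {j : ℕ} {s s' : Stk E n}
    (hs : s.dup h j = some s') : s'.pop j = some s := by
  induction n with
  | zero => cases hs
  | succ n ih =>
    obtain rfl | ⟨t, r, rfl⟩ := s.eq_nil_or_cons
    · cases hs
    · obtain ⟨hj, rfl⟩ | ⟨hj, u, hu, rfl⟩ := dup_cons_eq_some hs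
      · rw [pop_cons, if_pos hj]
      · exact pop_cons_of_ne hj (ih hu)

/-- The top order-`(j-1)` stack of the second stack is the image under `h` of that of the first. -/
def TopMap (h : E → E) (j : ℕ) : {n : ℕ} → Stk E n → Stk E n → Prop
  | 0, a, b => b = h a
  | n + 1, s, s' =>
    n + 1 < j ∧ s' = map h s ∨
      ¬ n + 1 < j ∧ ∃ t r t' r', s = cons t r ∧ s' = cons t' r' ∧ TopMap h j t t'

theorem TopMap.of_lt {h : E → E} {j : ℕ} (hn : n < j) (s : Stk E n) : TopMap h j s (s.map h) := by
  cases n with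
  | zero => rfl
  | succ n => exact .inl ⟨hn, rfl⟩

theorem TopMap.of_dup {h : E → E} {j : ℕ} {s s' : Stk E n}
    (hs : s.dup (fun t => t.map h) j = some s') : TopMap h j s s' := by
  induction n with
  | zero => cases hs
  | succ n ih =>
    obtain rfl | ⟨t, r, rfl⟩ := s.eq_nil_or_cons
    · cases hs
    · obtain ⟨hj, rfl⟩ | ⟨hj, u, hu, rfl⟩ := dup_cons_eq_some hs
      · exact .inr ⟨by omega, _, _, _, _, rfl, rfl, .of_lt (by omega) t⟩
      · refine .inr ⟨fun hlt => ?_, _, _, _, _, rfl, rfl, ih hu⟩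
        have := pop_dup hu
        rw [pop_of_lt (by omega)] at this
        cases this

theorem TopMap.top1_eq {h : E → E} {j : ℕ} {s s' : Stk E n} (hs : TopMap h j s s') :
    s'.top1 = s.top1.map h := by
  induction n with
  | zero => exact congrArg some hs
  | succ n ih =>
    obtain ⟨-, rfl⟩ | ⟨-, t, r, t', r', rfl, rfl, ht⟩ := hs
    · exact top1_map h s
    · exact ih ht

/-- Pops of order below `j` stay inside the top order-`(j-1)` stack, so a copy can follow the
original step by step. -/
theorem TopMap.exists_pop {h : E → E} {i j : ℕ} {s s' r : Stk E n} (hij : i < j)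
    (hs : TopMap h j s s') (hr : s.pop i = some r) :
    ∃ r', s'.pop i = some r' ∧ TopMap h j r r' := by
  induction n with
  | zero => cases hr
  | succ n ih =>
    obtain ⟨hn, rfl⟩ | ⟨hn, t, u, t', u', rfl, rfl, ht⟩ := hs
    · rw [pop_map, hr]
      exact ⟨_, rfl, .of_lt hn r⟩
    · obtain ⟨hi, -⟩ | ⟨hi, v, hv, rfl⟩ := pop_cons_eq_some hr
      · omega
      · obtain ⟨v', hv', hvv⟩ := ih ht hv
        exact ⟨_, pop_cons_of_ne hi hv', .inr ⟨hn, _, _, _, _, rfl, rfl, hvv⟩⟩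

end Stk

/-! # Replacing `collapse` by `pop` -/

section Replace

variable {T : Type*} {ar : T → ℕ} {n : ℕ}

theorem LinkSym.sym_incr {Γ : Type*} (j : ℕ) (a : LinkSym Γ) : (a.incr j).sym = a.sym := by
  unfold LinkSym.incr
  split_ifs <;> rfl

theorem LinkSym.incr_of_ne {Γ : Type*} {j : ℕ} {a : LinkSym Γ} (h : a.ord ≠ j) : a.incr j = a :=
  if_neg h

/-- Forget the links of a stack. -/
def Stk.eraseLinks {Γ : Type*} (s : Stk (LinkSym Γ) n) : Stk Γ n := s.mapTo LinkSym.sym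

/-- On the stack `s`, the operation `θ` acts as its replacement that ignores links and performs
`pop_(r a)` instead of `collapse` when the top symbol is `a`. -/
def CPDAOp.Replaceable {Γ : Type*} (r : Γ → ℕ) (s : Stk (LinkSym Γ) n) : CPDAOp Γ → Prop
  | .push1 _ i => 1 ≤ i ∧ i ≤ n
  | .collapse => ∀ a, s.top1 = some a → a.ord = r a.sym ∧ a.height = 1
  | _ => True

/-- Links influence a move only through `collapse`, which at height 1 is a single pop, and through
the range check on the link order in `push1`. -/
theorem CPDA.replaceCollapse_move (A : CPDA ar n) (r : A.Γ → ℕ) (q : A.Q)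
    (s : Stk (LinkSym A.Γ) n)
    (h : ∀ a q' θ, s.top1 = some a → A.δ q a.sym = some (.op q' θ) → θ.Replaceable r s) :
    (A.replaceCollapse r).move (q, s.eraseLinks) =
      (A.move (q, s)).map (Move.map fun c => (c.1, c.2.eraseLinks)) := by
  simp only [PDA.move, CPDA.move, replaceCollapse, Stk.eraseLinks, Stk.top1_mapTo]
  rcases hs : s.top1 with _ | a
  · rfl
  simp only [Option.map_some, Option.bind_some]
  rcases hδ : A.δ q a.sym with _ | (⟨q', θ⟩ | ⟨f, k⟩)
  · rfl
  · have hθ := h a q' θ hs hδ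
    rcases θ with ⟨b, i⟩ | j | j | _
    · simp only [Option.map_some, Option.bind_some, PDAOp.apply, CPDAOp.apply]
      rw [if_pos (show 1 ≤ i ∧ i ≤ n from hθ),
        show Stk.push1 b (s.mapTo LinkSym.sym) = _ from Stk.push1_mapTo LinkSym.sym ⟨b, i, 1⟩ s,
        Option.map_map, Option.map_map]
      rfl
    · simp only [Option.map_some, Option.bind_some, PDAOp.apply, CPDAOp.apply]
      split_ifs
      · rw [Stk.dup_mapTo _ _ (LinkSym.sym_incr j), Option.map_map, Option.map_map]
        rfl
      · rfl
    · simp only [Option.map_some, Option.bind_some, PDAOp.apply, CPDAOp.apply]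
      rw [Stk.pop_mapTo, Option.map_map, Option.map_map]
      rfl
    · obtain ⟨h1, h2⟩ := hθ a hs
      simp only [Option.map_some, Option.bind_some, PDAOp.apply, CPDAOp.apply, hs, h2,
        Function.iterate_one, h1]
      rw [Stk.pop_mapTo, Option.map_map, Option.map_map]
      rfl
  · rfl

end Replace

/-! # Well-formedness of computation trees -/

theorem Ty.args_ofArity (k : ℕ) : (Ty.ofArity k).args = List.replicate k Ty.o := by
  induction k with
  | zero => rfl
  | succ k ih => rw [ofArity, args, ih, List.replicate_succ]

namespace Lab

variable {T N : Type*}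

/-- An argument of type `A` is eta-expanded to a lambda node binding `A.args`; this identifies the
order of a parameter with that of the lambda node pushed for it. -/
theorem order_lam_args (A : Ty) : (lam A.args : Lab T N).order = A.order := by
  induction A with
  | o => rfl
  | arr A B _ ih =>
    simp only [order] at ih
    simp only [order, Ty.args, List.map_cons, List.foldr_cons, Ty.order, ih]

/-- The types of the variables bound at a lambda node. -/
def binds : Lab T N → Option (List Ty)
  | lam Bs => some Bs
  | _ => none

theorem eq_lam_of_binds {l : Lab T N} {Bs : List Ty} (h : l.binds = some Bs) : l = lam Bs := by
  cases l <;> simp_all [binds]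

theorem eq_lam_of_isLam {l : Lab T N} (h : l.isLam = true) : ∃ Bs, l = lam Bs := by
  cases l <;> simp_all [isLam]

/-- The types of the arguments to which the head symbol at a node is applied. -/
def argTypes (ar : T → ℕ) (ty : N → Ty) : Lab T N → List Ty
  | lam _ => []
  | var _ _ A => A.args
  | sym f => List.replicate (ar f) Ty.o
  | app F => (ty F).args

/-- A child, at index `i`, of a node with the first label may have the second one. -/
def ChildOK (ar : T → ℕ) (ty : N → Ty) (l : Lab T N) (i : ℕ) (l' : Lab T N) : Prop :=
  if l.isLam then l'.isLam = false
  else ∃ A, (l.argTypes ar ty)[i]? = some A ∧ l' = lam A.args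

end Lab

/-- Well-formedness of a subtree of a computation tree; `env` lists the types bound at the proper
ancestors of its root, starting from the root of the whole tree. -/
inductive LTree.WF {T N : Type*} (ar : T → ℕ) (ty : N → Ty) :
    List (Option (List Ty)) → LTree (Lab T N) → Prop
  | node {env : List (Option (List Ty))} {l : Lab T N} {ts : List (LTree (Lab T N))} :
    (∀ b i A, l = .var b i A → ∃ Bs, env[b]? = some (some Bs) ∧ Bs[i]? = some A) →
    (∀ (i : ℕ) (t : LTree (Lab T N)), ts[i]? = some t → l.ChildOK ar ty i t.label) →
    (∀ (i : ℕ) (t : LTree (Lab T N)), ts[i]? = some t → WF ar ty (env ++ [l.binds]) t) →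
    WF ar ty env (.node l ts)

section WF

variable {T N : Type*} {ar : T → ℕ} {ty : N → Ty}

theorem LTree.WF.childOK {env : List (Option (List Ty))} {t : LTree (Lab T N)}
    (h : t.WF ar ty env) {i : ℕ} {t' : LTree (Lab T N)} (ht : t.children[i]? = some t') :
    t.label.ChildOK ar ty i t'.label := by
  cases h with
  | node _ h _ => exact h i t' ht

theorem LTree.WF.child {env : List (Option (List Ty))} {t : LTree (Lab T N)}
    (h : t.WF ar ty env) {i : ℕ} {t' : LTree (Lab T N)} (ht : t.children[i]? = some t') :
    t'.WF ar ty (env ++ [t.label.binds]) := by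
  cases h with
  | node _ _ h => exact h i t' ht

theorem LTree.WF.var {env : List (Option (List Ty))} {t : LTree (Lab T N)}
    (h : t.WF ar ty env) {b i : ℕ} {A : Ty} (ht : t.label = .var b i A) :
    ∃ Bs, env[b]? = some (some Bs) ∧ Bs[i]? = some A := by
  cases h with
  | node h _ _ => exact h b i A ht

/-- Well-formed arguments, in the environment `env`, of a head symbol of type `A`. -/
def ArgsWF (ar : T → ℕ) (ty : N → Ty) (env : List (Option (List Ty))) (A : Ty)
    (ts : List (LTree (Lab T N))) : Prop :=
  ∀ (i : ℕ) (t : LTree (Lab T N)), ts[i]? = some t →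
    ∃ B, A.args[i]? = some B ∧ t.label = .lam B.args ∧ t.WF ar ty env

theorem LTree.WF.of_args {env : List (Option (List Ty))} {l : Lab T N} {A : Ty}
    {ts : List (LTree (Lab T N))} (hl : l.isLam = false) (hA : l.argTypes ar ty = A.args)
    (hv : ∀ b i A, l = .var b i A → ∃ Bs, env[b]? = some (some Bs) ∧ Bs[i]? = some A)
    (h : ArgsWF ar ty (env ++ [none]) A ts) : (LTree.node l ts).WF ar ty env := by
  refine .node hv (fun i t ht => ?_) fun i t ht => ?_
  · obtain ⟨B, hB, ht, -⟩ := h i t ht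
    simpa [Lab.ChildOK, hl, hA] using ⟨B, hB, ht⟩
  · obtain ⟨B, -, -, ht⟩ := h i t ht
    rwa [show l.binds = none by cases l <;> simp_all [Lab.isLam, Lab.binds]]

theorem LTree.WF.lam {env : List (Option (List Ty))} {Bs : List Ty} {t : LTree (Lab T N)}
    (ht : t.label.isLam = false) (h : t.WF ar ty (env ++ [some Bs])) :
    (LTree.node (.lam Bs) [t]).WF ar ty env := by
  refine .node (by simp) (fun i t' ht' => ?_) fun i t' ht' => ?_
  all_goals
    obtain rfl : t = t' := by
      rcases i with _ | i
      · simpa using ht'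
      · simp at ht'
  · exact ht
  · exact h

theorem ArgsWF.cons {env : List (Option (List Ty))} {A B : Ty} {t : LTree (Lab T N)}
    {ts : List (LTree (Lab T N))} (hl : t.label = .lam A.args) (ht : t.WF ar ty env)
    (h : ArgsWF ar ty env B ts) : ArgsWF ar ty env (.arr A B) (t :: ts) := by
  rintro (_ | i) t' ht'
  · obtain rfl : t = t' := by simpa using ht'
    exact ⟨A, rfl, hl, ht⟩
  · exact h i t' (by simpa using ht')

/-- The binder sits at depth `k` and the head symbol at `k + 1`, so the arguments have `k + 2`
proper ancestors. The offset `j` counts the bound variables already consumed in the recursion on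
`A`. -/
theorem argsWF_etaVars (A : Ty) (k j : ℕ) (env : List (Option (List Ty))) (Bs : List Ty)
    (hk : env.length = k + 2) (hb : env[k]? = some (some Bs))
    (hB : ∀ i, Bs[j + i]? = A.args[i]?) : ArgsWF ar ty env A (etaVars A k j) := by
  induction A generalizing k j env Bs with
  | o => intro i t ht; simp [etaVars] at ht
  | arr A B ihA ihB =>
    refine .cons rfl (.lam rfl (.of_args rfl rfl ?_ ?_)) ?_
    · rintro b i A' h
      cases h
      refine ⟨Bs, ?_, hB 0⟩
      rwa [List.getElem?_append_left (by omega)]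
    · refine ihA (k + 2) 0 _ A.args (by simp [hk]) ?_ (by simp)
      rw [List.append_assoc, List.getElem?_append_right (by omega)]
      simp [hk]
    · exact ihB k (j + 1) env Bs hk hb fun i => by
        rw [show j + 1 + i = j + (i + 1) by omega, hB]
        rfl

theorem isLam_label_spine {ctx : List Ty} {A : Ty} (e : ATerm ar ty ctx A) (k : ℕ)
    (ts : List (LTree (Lab T N))) : (e.spine k ts).label.isLam = false := by
  induction e generalizing k ts with
  | sym f => rfl
  | nt F => rfl
  | par i => rfl
  | app s t ihs _ => exact ihs _ _

theorem wf_spine {ctx : List Ty} {A : Ty} (e : ATerm ar ty ctx A) (k : ℕ)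
    (ts : List (LTree (Lab T N))) (env : List (Option (List Ty))) (hk : env.length = k)
    (h0 : env[0]? = some (some ctx)) (h : ArgsWF ar ty (env ++ [none]) A ts) :
    (e.spine k ts).WF ar ty env := by
  induction e generalizing k ts env with
  | sym f => exact .of_args rfl (Ty.args_ofArity _).symm (by simp) h
  | nt F => exact .of_args rfl rfl (by simp) h
  | par i =>
    refine .of_args rfl rfl ?_ h
    rintro b j A h
    cases h
    exact ⟨ctx, h0, by simp⟩
  | @app A B s t ihs iht =>
    have h0' : ∀ l, (env ++ l)[0]? = some (some ctx) := fun l => by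
      rw [List.getElem?_append_left, h0]
      exact (List.getElem?_eq_some_iff.1 h0).1
    refine ihs k _ env hk h0 (.cons rfl (.lam (isLam_label_spine _ _ _) ?_) h)
    refine iht (k + 2) _ _ (by simp [hk]) (by rw [List.append_assoc]; exact h0' _) ?_
    refine argsWF_etaVars A (k + 1) 0 _ A.args (by simp [hk]) ?_ (by simp)
    rw [List.append_assoc, List.append_assoc, List.getElem?_append_right (by omega)]
    simp [hk]

/-- Descending along `w` appends to the environment what each ancestor binds; the last clause allows
the binder of a variable to be read off from the position. -/
theorem LTree.WF.sub {env : List (Option (List Ty))} {t t' : LTree (Lab T N)} {w : List ℕ}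
    (h : t.WF ar ty env) (ht : t.sub w = some t') :
    ∃ env', t'.WF ar ty env' ∧ env'.length = env.length + w.length ∧
      (∀ b < env.length, env'[b]? = env[b]?) ∧
      ∀ b < w.length, ∃ u, t.sub (w.take b) = some u ∧
        env'[env.length + b]? = some u.label.binds := by
  induction w generalizing env t with
  | nil =>
    obtain rfl := Option.some.inj ht
    exact ⟨env, h, rfl, fun _ _ => rfl, by simp⟩
  | cons i w ih =>
    simp only [LTree.sub, Option.bind_eq_some_iff] at ht
    obtain ⟨t₁, h₁, ht⟩ := ht
    obtain ⟨env', hw, hlen, hold, hnew⟩ := ih (h.child h₁) ht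
    simp only [List.length_append, List.length_singleton] at hlen hold hnew
    refine ⟨env', hw, by simp; omega, fun b hb => ?_, fun b hb => ?_⟩
    · rw [hold b (by omega), List.getElem?_append_left hb]
    · rcases b with _ | b
      · refine ⟨t, rfl, ?_⟩
        rw [hold _ (by omega)]
        simp
      · obtain ⟨u, hu, hb'⟩ := hnew b (by simpa using hb)
        refine ⟨u, by simp [LTree.sub, h₁, hu], ?_⟩
        rw [← hb']
        congr 1
        omega

theorem LTree.sub_append_singleton {L : Type*} (t : LTree L) (w : List ℕ) (i : ℕ) :
    t.sub (w ++ [i]) = (t.sub w).bind fun u => u.children[i]? := by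
  induction w generalizing t with
  | nil => simp [LTree.sub]
  | cons j w ih => simp [LTree.sub, ih, Option.bind_assoc]

end WF

/-! ### Nodes of the computation graph and paths of its unfolding -/

namespace HORS

variable {T : Type*} {ar : T → ℕ} (G : HORS T ar)

theorem wf_ctree (F : G.N) : (G.ctree F).WF ar G.ty [] :=
  .lam (isLam_label_spine _ _ _) (wf_spine _ _ _ _ rfl rfl (by intro i t ht; simp at ht))

theorem label_root (F : G.N) : (G.root F).label = .lam (G.ty F).args := rfl

variable {G}

namespace Node

theorem label_eq {u : G.Node} {t : LTree (Lab T G.N)} (h : (G.ctree u.nt).sub u.pos = some t) :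
    u.label = t.label := by
  simp [label, h]

theorem exists_sub (u : G.Node) : ∃ t, (G.ctree u.nt).sub u.pos = some t ∧ u.label = t.label := by
  obtain ⟨t, ht⟩ := Option.isSome_iff_exists.1 u.valid
  exact ⟨t, ht, label_eq ht⟩

theorem E_zero {u v : G.Node} (h : u.E 0 = some v) : ∃ F, u.label = .app F ∧ v = G.root F := by
  simp only [E] at h
  split at h
  · exact ⟨_, ‹_›, (Option.some.inj h).symm⟩
  · cases h

theorem E_succ {u v : G.Node} {i : ℕ} (h : u.E (i + 1) = some v) :
    v.nt = u.nt ∧ v.pos = u.pos ++ [i] ∧ u.label.ChildOK ar G.ty i v.label := by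
  simp only [E] at h
  split_ifs at h with hv
  obtain rfl := Option.some.inj h
  refine ⟨rfl, rfl, ?_⟩
  obtain ⟨t, ht, htl⟩ := u.exists_sub
  obtain ⟨t', ht', htl'⟩ := exists_sub (⟨u.nt, u.pos ++ [i], hv⟩ : G.Node)
  rw [htl, htl']
  obtain ⟨env, hwf, -⟩ := (G.wf_ctree u.nt).sub ht
  refine hwf.childOK ?_
  simpa only [LTree.sub_append_singleton, ht, Option.bind_some] using ht'

theorem var_binder {u : G.Node} {b i : ℕ} {A : Ty} (h : u.label = .var b i A) :
    b < u.pos.length ∧ ∀ v : G.Node, v.nt = u.nt → v.pos = u.pos.take b →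
      ∃ Bs, v.label = .lam Bs ∧ Bs[i]? = some A := by
  obtain ⟨t, ht, htl⟩ := u.exists_sub
  obtain ⟨env, hwf, hlen, -, hnew⟩ := (G.wf_ctree u.nt).sub ht
  obtain ⟨Bs, hb, hi⟩ := hwf.var (htl.symm.trans h)
  have hlt : b < u.pos.length := by
    have := (List.getElem?_eq_some_iff.1 hb).1
    simpa [hlen] using this
  refine ⟨hlt, fun v hn hp => ⟨Bs, ?_, hi⟩⟩
  obtain ⟨w, hw, hw'⟩ := hnew b hlt
  rw [label_eq (t := w) (by rw [hn, hp, hw])]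
  simp only [List.length_nil, Nat.zero_add] at hw'
  rw [hw'] at hb
  exact Lab.eq_lam_of_binds (Option.some.inj hb)

/-- Prime nodes are roots, with empty position, whereas a proper child has a nonempty one. -/
theorem not_isPrime_of_E_succ {u v : G.Node} {i : ℕ} (h : u.E (i + 1) = some v) :
    ¬ v.IsPrime := by
  rintro ⟨w, hw⟩
  obtain ⟨F, -, rfl⟩ := E_zero hw
  have := (E_succ h).2.1
  simp [root] at this

end Node

/-- A path changes trees only by entering a root, so up to that root going back along the path
strips directions from the position. Thus the entry `span` steps above a variable is its binder. -/
theorem IsPath.getElem? {p : List G.Node} (h : G.IsPath p) :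
    ∀ x, p.head? = some x → ∀ k ≤ x.pos.length, ∃ y, p[k]? = some y ∧ y.nt = x.nt ∧
      y.pos = x.pos.take (x.pos.length - k) := by
  induction h with
  | root =>
    rintro _ ⟨⟩ k hk
    obtain rfl : k = 0 := by simpa [HORS.root] using hk
    exact ⟨_, rfl, rfl, rfl⟩
  | @child u v p i _ hE ih =>
    rintro _ ⟨⟩ k hk
    rcases k with _ | k
    · exact ⟨v, rfl, rfl, by simp⟩
    · rcases i with _ | i
      · obtain ⟨F, -, rfl⟩ := Node.E_zero hE
        simp [HORS.root] at hk
      · obtain ⟨hn, hp, -⟩ := Node.E_succ hE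
        rw [hp] at hk ⊢
        obtain ⟨y, hy, hyn, hyp⟩ := ih u rfl k (by simpa using hk)
        refine ⟨y, hy, hyn.trans hn.symm, ?_⟩
        rw [hyp, List.take_append_of_le_length (by simp)]
        simp

end HORS

/-! ### The link invariant -/

namespace HORS

variable {T : Type*} {ar : T → ℕ} (G : HORS T ar)

open Classical in
/-- The order of the `pop` operation that replaces `collapse` in `PDA(G)`. -/
noncomputable def collapseOrder (u : G.Node) : ℕ :=
  if u.IsPrime then 1 else G.order - u.order + 1

variable {G}

theorem Node.order_of_label {u : G.Node} {b i : ℕ} {A : Ty} (h : u.label = .var b i A) :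
    u.order = A.order := by
  rw [order, h]
  rfl

theorem Node.isLam_of_label {u : G.Node} {Bs : List Ty} (h : u.label = .lam Bs) :
    u.isLam = true := by
  rw [isLam, h]
  rfl

theorem order_root_start : (G.root G.start).order = 0 := by
  rw [Node.order, label_root, Lab.order_lam_args, G.ty_start]
  rfl

/-- `WellLinked s l p` says that the symbols of the top order-1 stack of `s` form the path `p` and
that `collapse` is right at each lambda node of `p` whose order exceeds `l` and the orders of all
lambda nodes above it: its link has height `1` and the order of the corresponding `pop` of
`PDA(G)`, and leads to a stack with the parent of the lambda node in the traversal on top, which is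
well-linked above the same bound. -/
inductive WellLinked : Stk (LinkSym G.Node) G.order → ℕ → List G.Node → Prop
  | start {s : Stk (LinkSym G.Node) G.order} {a : LinkSym G.Node} {l : ℕ} :
    s.top1 = some a → a.sym = G.root G.start → WellLinked s l [a.sym]
  | skip {s s' : Stk (LinkSym G.Node) G.order} {a : LinkSym G.Node} {l : ℕ} {p : List G.Node} :
    s.top1 = some a → s.pop 1 = some s' → G.IsPath (a.sym :: p) →
    (a.sym.isLam → a.sym.order ≤ l) → WellLinked s' l p → WellLinked s l (a.sym :: p)
  | link {s s' s'' : Stk (LinkSym G.Node) G.order} {a b : LinkSym G.Node} {l : ℕ}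
    {p q : List G.Node} :
    s.top1 = some a → s.pop 1 = some s' → G.IsPath (a.sym :: p) →
    l < a.sym.order → a.height = 1 → a.ord = G.collapseOrder a.sym → s.pop a.ord = some s'' →
    s''.top1 = some b → a.sym.label = .lam (b.sym.label.argTypes ar G.ty) →
    WellLinked s'' l q → WellLinked s' a.sym.order p → WellLinked s l (a.sym :: p)

namespace WellLinked

variable {s : Stk (LinkSym G.Node) G.order} {l : ℕ} {p : List G.Node}

theorem isPath (h : WellLinked s l p) : G.IsPath p := by
  cases h with
  | start _ h => rw [h]; exact .root
  | skip _ _ h => exact h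
  | link _ _ h => exact h

theorem exists_eq_cons (h : WellLinked s l p) {a : LinkSym G.Node} (ha : s.top1 = some a) :
    ∃ p', p = a.sym :: p' := by
  cases h with
  | start h | skip h | link h =>
    rw [ha] at h
    obtain rfl := Option.some.inj h
    exact ⟨_, rfl⟩

/-- Raising the bound leaves fewer records: a node whose order no longer exceeds the bound is
skipped, and its link is forgotten. -/
theorem mono (h : WellLinked s l p) {l' : ℕ} (hl : l ≤ l') : WellLinked s l' p := by
  induction h generalizing l' with
  | start h1 h2 => exact .start h1 h2
  | skip h1 h2 h3 h4 _ ih => exact .skip h1 h2 h3 (fun h => (h4 h).trans hl) (ih hl)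
  | @link s s' s'' a b l p q h1 h2 h3 h4 h5 h6 h7 h8 h9 _ _ ih ih' =>
    by_cases h : l' < a.sym.order
    · exact .link h1 h2 h3 h h5 h6 h7 h8 h9 (ih hl) (ih' le_rfl)
    · exact .skip h1 h2 h3 (fun _ => not_lt.1 h) (ih' (not_lt.1 h))

/-- The inequality that protects records from copying. The bound `hm` covers prime nodes, where the
collapse order is 1, and excludes truncation of `G.order - m` to zero. -/
theorem collapseOrder_lt {u : G.Node} {m : ℕ} (hm : 2 ≤ G.order - m + 1) (hu : m < u.order) :
    G.collapseOrder u < G.order - m + 1 := by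
  unfold collapseOrder
  split_ifs <;> omega

/-- Every relevant link has order below that of the copy, so it is not incremented and its target
lies inside the copied part, where the induction continues. -/
theorem topMap {m : ℕ} (hm : 2 ≤ G.order - m + 1) (h : WellLinked s l p) (hl : m ≤ l)
    {t : Stk (LinkSym G.Node) G.order}
    (ht : Stk.TopMap (LinkSym.incr (G.order - m + 1)) (G.order - m + 1) s t) :
    WellLinked t l p := by
  induction h generalizing t with
  | @start s a l h1 h2 =>
    have := ht.top1_eq
    rw [h1] at this
    rw [← LinkSym.sym_incr (G.order - m + 1) a] at h2 ⊢
    exact .start this h2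
  | @skip s s' a l p h1 h2 h3 h4 _ ih =>
    have := ht.top1_eq
    rw [h1] at this
    rw [← LinkSym.sym_incr (G.order - m + 1) a] at h3 h4 ⊢
    obtain ⟨t', ht', htm⟩ := ht.exists_pop (by omega) h2
    exact .skip this ht' h3 h4 (ih hl htm)
  | @link s s' s'' a b l p q h1 h2 h3 h4 h5 h6 h7 h8 h9 _ _ ih ih' =>
    have hlt := collapseOrder_lt hm (hl.trans_lt h4)
    rw [← h6] at hlt
    have := ht.top1_eq
    rw [h1, Option.map_some, LinkSym.incr_of_ne hlt.ne] at this
    obtain ⟨t', ht', htm⟩ := ht.exists_pop (by omega) h2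
    obtain ⟨t'', ht'', htm'⟩ := ht.exists_pop hlt h7
    have hb := htm'.top1_eq
    rw [h8] at hb
    exact .link this ht' h3 h4 h5 h6 ht'' hb (by rwa [LinkSym.sym_incr]) (ih hl htm')
      (ih' (hl.trans h4.le) htm)

theorem push_low (h : WellLinked s l p) {a : LinkSym G.Node} (ha : s.top1 = some a) {i : ℕ}
    {c : LinkSym G.Node} (hE : a.sym.E i = some c.sym) (hc : c.sym.isLam → c.sym.order ≤ l)
    {s' : Stk (LinkSym G.Node) G.order} (hs : s.push1 c = some s') :
    WellLinked s' l (c.sym :: p) := by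
  obtain ⟨p', rfl⟩ := h.exists_eq_cons ha
  exact .skip (Stk.top1_push1 hs) (Stk.pop_one_push1 hs) (h.isPath.child hE) hc h

/-- The new lambda node of order `l` hides all lambda nodes of order at most `l` below it, so
well-linkedness above `l` before the push yields it above 0 afterwards. -/
theorem push_link (h : WellLinked s l p) {a : LinkSym G.Node} (ha : s.top1 = some a) {i : ℕ}
    {c b : LinkSym G.Node} (hE : a.sym.E i = some c.sym) (hc : c.sym.order = l)
    {s' s'' : Stk (LinkSym G.Node) G.order} (hs : s.push1 c = some s') (hh : c.height = 1)
    (ho : c.ord = G.collapseOrder c.sym) (hp : s'.pop c.ord = some s'') (hb : s''.top1 = some b)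
    (hcb : c.sym.label = .lam (b.sym.label.argTypes ar G.ty)) {q : List G.Node}
    (hq : WellLinked s'' 0 q) : WellLinked s' 0 (c.sym :: p) := by
  subst hc
  -- A node of order 0 is never a record, so its link does not matter.
  rcases Nat.eq_zero_or_pos c.sym.order with h0 | h0
  · rw [h0] at h
    exact h.push_low ha hE (fun _ => h0.le) hs
  · obtain ⟨p', rfl⟩ := h.exists_eq_cons ha
    exact .link (Stk.top1_push1 hs) (Stk.pop_one_push1 hs) (h.isPath.child hE) h0 hh ho hp hb
      hcb hq h

end WellLinked

/-- If `A` has positive order, then the top order-`(n - ord A)` stack of `s` was copied when the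
variable node `x` was on top. -/
def Copied (x : G.Node) (A : Ty) (s : Stk (LinkSym G.Node) G.order) : Prop :=
  1 ≤ A.order → 2 ≤ G.order - A.order + 1 ∧ ∃ s₀ a p, s.pop (G.order - A.order + 1) = some s₀ ∧
    s₀.top1 = some a ∧ a.sym = x ∧ WellLinked s₀ 0 p

/-- The configurations before the final `push₁` of the step of the variable node `x : A`, the
parameter of its binder at index `i`. -/
def Enterable (x : G.Node) (i : ℕ) (A : Ty) (s : Stk (LinkSym G.Node) G.order) : Prop :=
  Copied x A s ∧ ∃ a p, s.top1 = some a ∧ WellLinked s A.order p ∧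
    (a.sym.label.argTypes ar G.ty)[i]? = some A

/-- The configurations before the last `r` operations `pop₁` of the step of the variable node
`x : A`, the parameter of its binder at index `i`. -/
def Unwinds (x : G.Node) (i : ℕ) (A : Ty) : ℕ → Stk (LinkSym G.Node) G.order → Prop
  | 0, s => ∃ a s', s.top1 = some a ∧ a.height = 1 ∧ a.ord = G.collapseOrder a.sym ∧
      s.pop a.ord = some s' ∧ Enterable x i A s'
  | r + 1, s => ∃ s', s.pop 1 = some s' ∧ Unwinds x i A r s'

theorem Copied.pop {x : G.Node} {A : Ty} {s s' : Stk (LinkSym G.Node) G.order} {j : ℕ}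
    (h : Copied x A s) (hj : 2 ≤ G.order - A.order + 1 → j < G.order - A.order + 1)
    (hs : s.pop j = some s') : Copied x A s' := by
  intro hA
  obtain ⟨h2, s₀, a, p, h3, h4⟩ := h hA
  exact ⟨h2, s₀, a, p, Stk.pop_pop_of_lt (hj h2) h3 hs, h4⟩

/-- The first lambda node of order above `A.order` is the first record above that bound: the nodes
before it are skipped by `pop₁`, and its link is correct. -/
theorem WellLinked.unwinds {x : G.Node} {i : ℕ} {A : Ty} {s : Stk (LinkSym G.Node) G.order}
    {p : List G.Node} (h : WellLinked s A.order p) (hc : Copied x A s) {y : G.Node} {Bs : List Ty}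
    (hy : p[p.findIdx fun u => u.isLam && decide (A.order < u.order)]? = some y)
    (hyl : y.label = .lam Bs) (hB : Bs[i]? = some A) :
    Unwinds x i A (p.findIdx fun u => u.isLam && decide (A.order < u.order)) s := by
  generalize hl : A.order = l at h
  induction h with
  | @start s a l _ h =>
    -- The root of the start symbol has order 0, so it cannot be the node found.
    subst hl
    rw [List.findIdx_cons, h, order_root_start] at hy
    simp at hy
  | @skip s s' a l p h1 h2 h3 h4 _ ih =>
    subst hl
    have hf : (a.sym.isLam && decide (A.order < a.sym.order)) = false := by
      simpa using h4
    rw [List.findIdx_cons, hf] at hy ⊢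
    exact ⟨s', h2, ih (hc.pop (by omega) h2) (by simpa using hy) rfl⟩
  | @link s s' s'' a b l p q h1 h2 h3 h4 h5 h6 h7 h8 h9 h10 _ ih ih' =>
    subst hl
    have ht : (a.sym.isLam && decide (A.order < a.sym.order)) = true := by
      simpa [Node.isLam_of_label h9] using h4
    rw [List.findIdx_cons, ht] at hy ⊢
    obtain rfl : a.sym = y := by simpa using hy
    rw [h9] at hyl
    cases hyl
    refine ⟨a, s'', h1, h5, h6, h7, hc.pop (fun h => ?_) h7, b, q, h8, h10, hB⟩
    rw [h6]
    exact WellLinked.collapseOrder_lt h h4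

/-- In an incrementally-bound scheme, the `pop₁` operations in the step of a variable node on top of
a well-linked stack lead to its binder. -/
theorem IncrementallyBound.unwinds (hG : G.IncrementallyBound)
    {s : Stk (LinkSym G.Node) G.order} {p : List G.Node} {x : G.Node} {b i : ℕ} {A : Ty}
    (hx : x.label = .var b i A) (h : WellLinked s A.order (x :: p)) (hc : Copied x A s) :
    1 ≤ x.span ∧ Unwinds x i A x.span s := by
  have hspan := hG x p b i A h.isPath hx
  rw [Node.order_of_label hx] at hspan
  -- The variable on top is not a lambda node, which accounts for the `+ 1` in the definition of
  -- incremental binding.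
  have hidx : (x :: p).findIdx (fun u => u.isLam && decide (A.order < u.order)) = x.span := by
    rw [List.findIdx_cons, show x.isLam = false by rw [Node.isLam, hx]; rfl]
    exact hspan
  obtain ⟨hb, hbind⟩ := Node.var_binder hx
  have hs : x.span = x.pos.length - b := by simp only [Node.span, hx]
  obtain ⟨y, hy, hyn, hyp⟩ := h.isPath.getElem? x rfl x.span (by omega)
  obtain ⟨Bs, hyl, hB⟩ := hbind y hyn (by rw [hyp]; congr 1; omega)
  refine ⟨by omega, ?_⟩
  have := h.unwinds hc (by rw [hidx]; exact hy) hyl hB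
  rwa [hidx] at this

/-- The invariant of the computations of `CPDA(G)`. -/
def Invariant : G.State × Stk (LinkSym G.Node) G.order → Prop
  | (.main, s) => ∃ p, WellLinked s 0 p
  | (.branch u _, s) => ∃ a p, s.top1 = some a ∧ a.sym = u ∧ WellLinked s 0 p
  | (.unwind x r, s) => ∃ b i A, x.label = .var b i A ∧ Unwinds x i A r s
  | (.enter x, s) => ∃ b i A, x.label = .var b i A ∧ Enterable x i A s

/-! ### Preservation of the invariant -/

theorem invariant_init (d : G.Node → ℕ) :
    Invariant (.main, Stk.single ⟨G.root G.start, d (G.root G.start), 1⟩ G.order) :=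
  ⟨_, .start (Stk.top1_single _ _) rfl⟩

theorem push1_apply_eq_some {c : G.Node} {j : ℕ} {s s' : Stk (LinkSym G.Node) G.order}
    (h : (CPDAOp.push1 c j).apply s = some s') : s.push1 ⟨c, j, 1⟩ = some s' := by
  simp only [CPDAOp.apply] at h
  split_ifs at h
  exact h

theorem dup_apply_eq_some {j : ℕ} {s s' : Stk (LinkSym G.Node) G.order}
    (h : (CPDAOp.push j).apply s = some s') :
    2 ≤ j ∧ s.dup (fun t => t.map (LinkSym.incr j)) j = some s' := by
  simp only [CPDAOp.apply] at h
  split_ifs at h with hj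
  exact ⟨hj, h⟩

theorem label_of_childOK {u v : G.Node} {i : ℕ} (hE : u.E (i + 1) = some v) {A : Ty}
    (h : (u.label.argTypes ar G.ty)[i]? = some A) : v.label = .lam A.args := by
  have hc := (Node.E_succ hE).2.2
  unfold Lab.ChildOK at hc
  split_ifs at hc with hl
  · obtain ⟨Bs, hBs⟩ := Lab.eq_lam_of_isLam hl
    simp [hBs, Lab.argTypes] at h
  · obtain ⟨B, hB, hv⟩ := hc
    rw [h] at hB
    cases hB
    exact hv

theorem order_of_label_lam_args {v : G.Node} {A : Ty} (h : v.label = .lam A.args) :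
    v.order = A.order := by
  rw [Node.order, h, Lab.order_lam_args]

variable {d : G.Node → ℕ} {s : Stk (LinkSym G.Node) G.order} {a : LinkSym G.Node}

theorem invariant_main_op (hG : G.IncrementallyBound) (hd : ∀ u : G.Node, 1 ≤ d u ∧ d u ≤ G.order)
    (h : Invariant (.main, s)) (ha : s.top1 = some a) {q : G.State} {θ : CPDAOp G.Node}
    (hδ : G.delta d .main a.sym = some (.op q θ)) :
    θ.Replaceable G.collapseOrder s ∧ ∀ s', θ.apply s = some s' → Invariant (q, s') := by
  obtain ⟨p, hp⟩ := h
  -- The order of `G` is positive because the range of `d` lies in `{1, …, n}`.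
  have hn := (hd a.sym).1.trans (hd a.sym).2
  simp only [delta] at hδ
  split at hδ
  · rename_i F hF
    obtain ⟨v, hv, hδ⟩ := Option.map_eq_some_iff.1 hδ
    cases hδ
    refine ⟨⟨le_rfl, hn⟩, fun s' hs => ?_⟩
    have hs := push1_apply_eq_some hs
    have hprime : v.IsPrime := ⟨a.sym, hv⟩
    obtain ⟨F', hF', hvr⟩ := Node.E_zero hv
    have hord : 1 = G.collapseOrder v := by rw [collapseOrder, if_pos hprime]
    -- Collapsing at a prime node is `pop₁`, which uncovers the application node itself.
    refine ⟨_, (hp.mono (Nat.zero_le v.order)).push_link (c := ⟨v, 1, 1⟩) ha hv rfl hs rfl hord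
      (Stk.pop_one_push1 hs) ha ?_ hp⟩
    rw [hF', hvr]
    rfl
  · cases hδ
  · rename_i Bs hBs
    obtain ⟨v, hv, hδ⟩ := Option.map_eq_some_iff.1 hδ
    cases hδ
    refine ⟨hd v, fun s' hs => ?_⟩
    have hs := push1_apply_eq_some hs
    have hc := (Node.E_succ hv).2.2
    rw [Lab.ChildOK, hBs] at hc
    have hc : v.isLam = false := hc
    exact ⟨_, hp.push_low (c := ⟨v, d v, 1⟩) ha hv (by simp [hc]) hs⟩
  · rename_i b i A hA
    obtain ⟨p', rfl⟩ := hp.exists_eq_cons ha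
    split_ifs at hδ with h1
    · cases hδ
      refine ⟨trivial, fun s' hs => ?_⟩
      -- That the copy has order at least 2 is read off from its being defined; otherwise the
      -- automaton is stuck.
      obtain ⟨h2, hs⟩ := dup_apply_eq_some hs
      refine ⟨b, i, A, hA, (hG.unwinds (p := p') hA ?_ fun _ => ?_).2⟩
      · exact (hp.mono (Nat.zero_le _)).topMap h2 le_rfl (.of_dup hs)
      · exact ⟨h2, s, a, _, Stk.pop_dup hs, ha, rfl, hp⟩
    · cases hδ
      refine ⟨trivial, fun s' hs => ⟨b, i, A, hA, ?_⟩⟩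
      obtain ⟨h3, h4⟩ := hG.unwinds hA (hp.mono (Nat.zero_le _)) fun h => absurd h h1
      -- The transition under consideration already performs the first `pop₁`, so `span - 1` of them
      -- remain.
      obtain ⟨r, hr⟩ : ∃ r, a.sym.span = r + 1 := ⟨_, (Nat.sub_add_cancel h3).symm⟩
      rw [hr] at h4
      obtain ⟨t, ht, hu⟩ := h4
      obtain rfl : t = s' := Option.some.inj (ht.symm.trans hs)
      simpa [hr] using hu

theorem invariant_branch_op (hd : ∀ u : G.Node, 1 ≤ d u ∧ d u ≤ G.order) {u : G.Node}
    {j : Fin u.rank} (h : Invariant (.branch u j, s)) (ha : s.top1 = some a) {q : G.State}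
    {θ : CPDAOp G.Node} (hδ : G.delta d (.branch u j) a.sym = some (.op q θ)) :
    θ.Replaceable G.collapseOrder s ∧ ∀ s', θ.apply s = some s' → Invariant (q, s') := by
  obtain ⟨a', p, ha', rfl, hp⟩ := h
  obtain rfl : a = a' := Option.some.inj (ha.symm.trans ha')
  simp only [delta] at hδ
  obtain ⟨v, hv, hδ⟩ := Option.map_eq_some_iff.1 hδ
  cases hδ
  refine ⟨hd v, fun s' hs => ?_⟩
  have hs := push1_apply_eq_some hs
  -- Arguments of terminals are of ground type, so the pushed lambda node has order 0 and its
  -- arbitrary link is harmless.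
  have ho : (a.sym.label.argTypes ar G.ty)[(j : ℕ)]? = some Ty.o := by
    obtain ⟨j, hj⟩ := j
    simp only [Node.rank] at hj
    split at hj
    · rename_i f hf
      simp [hf, Lab.argTypes, hj]
    · omega
  have hlow := order_of_label_lam_args (label_of_childOK hv ho)
  exact ⟨_, hp.push_low (c := ⟨v, d v, 1⟩) ha hv (fun _ => hlow.le) hs⟩

theorem invariant_unwind_op {x : G.Node} {r : Fin (x.span + 1)}
    (h : Invariant (.unwind x r, s)) (ha : s.top1 = some a) {q : G.State}
    {θ : CPDAOp G.Node} (hδ : G.delta d (.unwind x r) a.sym = some (.op q θ)) :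
    θ.Replaceable G.collapseOrder s ∧ ∀ s', θ.apply s = some s' → Invariant (q, s') := by
  obtain ⟨b, i, A, hA, hu⟩ := h
  obtain ⟨_ | r, hr⟩ := r
  · cases hδ
    obtain ⟨a', s'', ha', h1, h2, h3, h4⟩ := hu
    obtain rfl : a = a' := Option.some.inj (ha.symm.trans ha')
    refine ⟨fun a' ha' => ?_, fun s' hs => ⟨b, i, A, hA, ?_⟩⟩
    · obtain rfl : a = a' := Option.some.inj (ha.symm.trans ha')
      exact ⟨h2, h1⟩
    · simp only [CPDAOp.apply, ha, Option.bind_some, h1, Function.iterate_one, h3] at hs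
      rwa [← Option.some.inj hs]
  · cases hδ
    obtain ⟨t, ht, hu⟩ := hu
    refine ⟨trivial, fun s' hs => ⟨b, i, A, hA, ?_⟩⟩
    rwa [← Option.some.inj (ht.symm.trans hs)]

theorem invariant_enter_op (hd : ∀ u : G.Node, 1 ≤ d u ∧ d u ≤ G.order) {x : G.Node}
    (h : Invariant (.enter x, s)) (ha : s.top1 = some a) {q : G.State}
    {θ : CPDAOp G.Node} (hδ : G.delta d (.enter x) a.sym = some (.op q θ)) :
    θ.Replaceable G.collapseOrder s ∧ ∀ s', θ.apply s = some s' → Invariant (q, s') := by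
  obtain ⟨b, i, A, hA, hcop, a', p, ha', hp, hi⟩ := h
  obtain rfl : a = a' := Option.some.inj (ha.symm.trans ha')
  have hn := (hd a.sym).1.trans (hd a.sym).2
  simp only [delta, hA] at hδ
  obtain ⟨v, hv, hδ⟩ := Option.map_eq_some_iff.1 hδ
  cases hδ
  have hlab := label_of_childOK hv hi
  have hord := order_of_label_lam_args hlab
  split_ifs with h1
  · refine ⟨⟨by omega, by omega⟩, fun s' hs => ?_⟩
    have hs := push1_apply_eq_some hs
    obtain ⟨h2, s₀, c, q, h3, h4, rfl, h5⟩ := hcop h1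
    -- The link leads to `s₀`, the stack from before the copy, whose top is the variable; the final
    -- push does not affect a pop of order at least 2.
    refine ⟨_, hp.push_link (c := ⟨v, _, 1⟩) ha hv hord hs rfl ?_
      ((Stk.pop_push1 h2 hs).trans h3) h4 ?_ h5⟩
    · rw [collapseOrder, if_neg (Node.not_isPrime_of_E_succ hv), hord]
    · rw [hA]
      exact hlab
  · refine ⟨hd v, fun s' hs => ?_⟩
    have hs := push1_apply_eq_some hs
    have h0 : A.order = 0 := by omega
    rw [h0] at hp hord
    exact ⟨_, hp.push_low (c := ⟨v, d v, 1⟩) ha hv (fun _ => hord.le) hs⟩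

theorem invariant_op (hG : G.IncrementallyBound) (hd : ∀ u : G.Node, 1 ≤ d u ∧ d u ≤ G.order)
    {q q' : G.State} (h : Invariant (q, s)) (ha : s.top1 = some a) {θ : CPDAOp G.Node}
    (hδ : G.delta d q a.sym = some (.op q' θ)) :
    θ.Replaceable G.collapseOrder s ∧ ∀ s', θ.apply s = some s' → Invariant (q', s') := by
  cases q with
  | main => exact invariant_main_op hG hd h ha hδ
  | branch u j => exact invariant_branch_op hd h ha hδ
  | unwind x r => exact invariant_unwind_op h ha hδ
  | enter x => exact invariant_enter_op hd h ha hδ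

theorem invariant_out {q : G.State} (h : Invariant (q, s)) (ha : s.top1 = some a) {f : T}
    {k : Fin (ar f) → G.State} (hδ : G.delta d q a.sym = some (.out f k)) (i : Fin (ar f)) :
    Invariant (k i, s) := by
  cases q with
  | main =>
    obtain ⟨p, hp⟩ := h
    simp only [delta] at hδ
    split at hδ
    · obtain ⟨_, _, hδ⟩ := Option.map_eq_some_iff.1 hδ
      cases hδ
    · cases hδ
      exact ⟨a, p, ha, rfl, hp⟩
    · obtain ⟨_, _, hδ⟩ := Option.map_eq_some_iff.1 hδ
      cases hδ
    · split_ifs at hδ <;> cases hδ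
  | branch u j =>
    obtain ⟨_, _, hδ⟩ := Option.map_eq_some_iff.1 hδ
    cases hδ
  | unwind x r => obtain ⟨_ | r, hr⟩ := r <;> cases hδ
  | enter x =>
    simp only [delta] at hδ
    split at hδ
    · obtain ⟨_, _, hδ⟩ := Option.map_eq_some_iff.1 hδ
      cases hδ
    · cases hδ

end HORS

/-! ### Equality of the generated trees -/

theorem mainTheorem2 {T : Type*} {ar : T → ℕ} (G : HORS T ar) (hG : G.IncrementallyBound)
    (d : G.Node → ℕ) (hd : ∀ u : G.Node, 1 ≤ d u ∧ d u ≤ G.order) :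
    (G.pda d).tree = (G.cpda d).tree := by
  funext w
  have key := Move.tree_map (β := (G.cpda d).move) (β' := (G.pda d).move)
    (f := fun c => (c.1, c.2.eraseLinks)) (I := HORS.Invariant (G := G)) ?_ ?_ ?_ w _
    (HORS.invariant_init d)
  · refine Eq.trans ?_ key
    exact congrArg (fun s => Move.tree (G.pda d).move (HORS.State.main, s) w)
      (Stk.mapTo_single LinkSym.sym (LinkSym.mk (G.root G.start) _ _) G.order).symm
  · rintro ⟨q, s⟩ h
    exact CPDA.replaceCollapse_move (G.cpda d) G.collapseOrder q s fun a q' θ ha hδ =>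
      (HORS.invariant_op hG hd h ha hδ).1
  · rintro ⟨q, s⟩ c h hc
    simp only [CPDA.move, Option.bind_eq_some_iff] at hc
    obtain ⟨a, ha, tr, hδ, hc⟩ := hc
    rcases tr with ⟨q', θ⟩ | ⟨f, k⟩
    · obtain ⟨s', hs, hc⟩ := Option.map_eq_some_iff.1 hc
      cases hc
      exact (HORS.invariant_op hG hd h ha hδ).2 s' hs
    · cases hc
  · rintro ⟨q, s⟩ g k h hc i
    simp only [CPDA.move, Option.bind_eq_some_iff] at hc
    obtain ⟨a, ha, tr, hδ, hc⟩ := hc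
    rcases tr with ⟨q', θ⟩ | ⟨f, k'⟩
    · obtain ⟨s', hs, hc⟩ := Option.map_eq_some_iff.1 hc
      cases hc
    · cases hc
      exact HORS.invariant_out h ha hδ i
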